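/- Let $d\ge 2$ be an integer and $\lambda\in[0,1]$. All logarithms are to base $2$, and $0\log 0=0$. Let $\sigma=\sigma_{AB}$ be the $d$-dimensional Werner state on $\mathbb C^d\otimes\mathbb C^d$, $$\sigma_{AB}=\frac{2(1-\lambda)}{d(d+1)}\,\Pi^{+}+\frac{2\lambda}{d(d-1)}\,\Pi^{-},$$ where $\Pi^{+}$ and $\Pi^{-}$ are the orthogonal projectors onto the symmetric and the antisymmetric subspace. Let $\{|z\rangle\}_{z=0}^{d-1}$ be an orthonormal basis of $\mathbb C^d$, let $|\tilde x\rangle=d^{-1/2}\sum_{z}e^{2\pi i xz/d}|z\rangle$ for $x=0,\dots,d-1$, and let $Z=\{|z\rangle\langle z|\}$ and $X=\{|\tilde x\rangle\langle\tilde x|\}$ be the corresponding (Fourier-conjugate) measurements of the system $A$. Notation. $S(\rho)=-\mathrm{Tr}\{\rho\log\rho\}$, $S(A|B)=S(\rho_{AB})-S(\rho_B)$ and $I(A;B)=S(\rho_A)+S(\rho_B)-S(\rho_{AB})$. For a POVM $P=\{\Lambda_p\}$ (with finitely many outcomes) on $A$, put $\rho_{PB}=\sum_p|p\rangle\langle p|\otimes\mathrm{Tr}_A\{(\Lambda_p\otimes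 I)\rho_{AB}\}$, let $S(P|B)=S(\rho_{PB})-S(\rho_B)$, and let $I(P;B)$ be the mutual information of $\rho_{PB}$. The classical correlation is $J_A(\rho_{AB})=\max_P I(P;B)$ over all POVMs $P$ on $A$, the quantum discord is $D_A(\rho_{AB})=I(A;B)-J_A(\rho_{AB})$, and the incompatibility of two POVMs $P=\{\Lambda_p\}$, $Q=\{\Gamma_q\}$ is $c(P,Q)=\max_{p,q}\|\sqrt{\Lambda_p}\sqrt{\Gamma_q}\|_\infty$ (operator norm), which is $\max_{p,q}|\langle p|q\rangle|$ for rank-one projective measurements. Then, for $\rho_{AB}=\sigma_{AB}$, the maximum that defines $J_A(\sigma_{AB})$ is attained, the uncertainty sum and the new lower bound coincide, and $$S(Z|B)+S(X|B)=-2\log c(Z,X)+S(A|B)+D_A(\sigma_{AB})-J_A(\sigma_{AB})$$ $$=-2\log c(Z,X)+S(A|B)+\max\{0,\,D_A(\sigma_{AB})-J_A(\sigma_{AB})\}$$ $$=-\frac{4(1-\lambda)}{d+1}\log\frac{2(1-\lambda)}{d+1}-\frac{2(d-1+2\lambda)}{d+1}\log\frac{d-1+2\lambda}{d^2-1},$$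 while the lower bound of Berta et al. is $$-2\log c(Z,X)+S(A|B)=-\lambda\log\frac{2\lambda}{d(d-1)}-(1-\lambda)\log\frac{2(1-\lambda)}{d(d+1)}.$$ -/

import Mathlib

open scoped Kronecker ComplexOrder

namespace QuantumMemory

/-- The partial trace over the first factor, `Tr_A ρ_AB`. -/
def traceLeft {a b : Type*} [Fintype a] (ρ : Matrix (a × b) (a × b) ℂ) : Matrix b b ℂ :=
  Matrix.of fun i j => ∑ k, ρ (k, i) (k, j)

/-- The partial trace over the second factor, `Tr_B ρ_AB`. -/
def traceRight {a b : Type*} [Fintype b] (ρ : Matrix (a × b) (a × b) ℂ) : Matrix a a ℂ :=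
  Matrix.of fun i j => ∑ k, ρ (i, k) (j, k)

/-- The von Neumann entropy `S(ρ) = - Tr (ρ log₂ ρ)` of a Hermitian matrix, in bits. The logarithm
is taken by functional calculus; the value of `logb 2` at the eigenvalue `0` does not matter, as it
is multiplied by that eigenvalue (`0 log 0 = 0`). -/
noncomputable def entropy {a : Type*} [Fintype a] [DecidableEq a] (ρ : Matrix a a ℂ) : ℝ :=
  -(ρ * cfc (Real.logb 2) ρ).trace.re

/-- The conditional entropy `S(A|B) = S(ρ_AB) - S(ρ_B)`. -/
noncomputable def condEntropy {a b : Type*} [Fintype a] [DecidableEq a] [Fintype b] [DecidableEq b]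
    (ρ : Matrix (a × b) (a × b) ℂ) : ℝ :=
  entropy ρ - entropy (traceLeft ρ)

/-- The mutual information `I(A;B) = S(ρ_A) + S(ρ_B) - S(ρ_AB)`. -/
noncomputable def mutualInfo {a b : Type*} [Fintype a] [DecidableEq a] [Fintype b] [DecidableEq b]
    (ρ : Matrix (a × b) (a × b) ℂ) : ℝ :=
  entropy (traceRight ρ) + entropy (traceLeft ρ) - entropy ρ

/-- A positive operator-valued measure with outcomes in `ι` on a system with basis `a`. -/
structure POVM (ι a : Type*) [Fintype ι] [Fintype a] [DecidableEq a] where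
  effect : ι → Matrix a a ℂ
  posSemidef : ∀ x, (effect x).PosSemidef
  sum_eq_one : ∑ x, effect x = 1

/-- The state `ρ_XB = ∑ₓ |x⟩⟨x| ⊗ Tr_A {(Λₓ ⊗ I) ρ_AB}` of the measurement register and the memory
after the POVM `Λ` was performed on the first system. -/
noncomputable def postMeasurement {ι a b : Type*} [Fintype ι] [DecidableEq ι]
    [Fintype a] [DecidableEq a] [Fintype b] [DecidableEq b]
    (Λ : POVM ι a) (ρ : Matrix (a × b) (a × b) ℂ) : Matrix (ι × b) (ι × b) ℂ :=
  ∑ x, Matrix.single x x (1 : ℂ) ⊗ₖ traceLeft ((Λ.effect x ⊗ₖ (1 : Matrix b b ℂ)) * ρ)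

/-- The uncertainty `S(P|B)` about the outcome of the measurement `P` on the first system, given
the memory `B`. -/
noncomputable def measCondEntropy {ι a b : Type*} [Fintype ι] [DecidableEq ι]
    [Fintype a] [DecidableEq a] [Fintype b] [DecidableEq b]
    (P : POVM ι a) (ρ : Matrix (a × b) (a × b) ℂ) : ℝ :=
  condEntropy (postMeasurement P ρ)

/-- The incompatibility `c(P,Q) = max_{p,q} ‖√Λ_p √Γ_q‖` of two POVMs, with the operator norm of
matrices acting on the Euclidean space. For rank-one projective measurements
`Λ_p = |p⟩⟨p|`, `Γ_q = |q⟩⟨q|` this is `max_{p,q} |⟨p|q⟩|`. -/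
noncomputable def incompatibility {ι κ a : Type*} [Fintype ι] [Fintype κ]
    [Fintype a] [DecidableEq a] (P : POVM ι a) (Q : POVM κ a) : ℝ :=
  ⨆ pq : ι × κ, ‖Matrix.toEuclideanCLM (n := a) (𝕜 := ℂ)
    (cfc Real.sqrt (P.effect pq.1) * cfc Real.sqrt (Q.effect pq.2))‖

/-- The values `I(X;B)` obtained by measuring the first system with an arbitrary (finite) POVM. -/
def measuredInfos {a b : Type*} [Fintype a] [DecidableEq a] [Fintype b] [DecidableEq b]
    (ρ : Matrix (a × b) (a × b) ℂ) : Set ℝ :=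
  {I | ∃ (n : ℕ) (Υ : POVM (Fin n) a), I = mutualInfo (postMeasurement Υ ρ)}

/-- The classical correlation `J_A(ρ_AB)`, the maximum of `I(X;B)` over all POVMs on `A`. -/
noncomputable def classicalCorrelation {a b : Type*} [Fintype a] [DecidableEq a]
    [Fintype b] [DecidableEq b] (ρ : Matrix (a × b) (a × b) ℂ) : ℝ :=
  sSup (measuredInfos ρ)

/-- The quantum discord `D_A(ρ_AB) = I(A;B) - J_A(ρ_AB)`. -/
noncomputable def discord {a b : Type*} [Fintype a] [DecidableEq a]
    [Fintype b] [DecidableEq b] (ρ : Matrix (a × b) (a × b) ℂ) : ℝ :=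
  mutualInfo ρ - classicalCorrelation ρ

/-- The swap (flip) operator `F (|i⟩ ⊗ |j⟩) = |j⟩ ⊗ |i⟩`. -/
def swapMatrix (d : ℕ) : Matrix (Fin d × Fin d) (Fin d × Fin d) ℂ :=
  Matrix.of fun x y => if x = y.swap then 1 else 0

/-- The projector `Π⁺` onto the symmetric subspace of `ℂᵈ ⊗ ℂᵈ`. -/
noncomputable def symProj (d : ℕ) : Matrix (Fin d × Fin d) (Fin d × Fin d) ℂ :=
  (1 / 2 : ℂ) • (1 + swapMatrix d)

/-- The projector `Π⁻` onto the antisymmetric subspace of `ℂᵈ ⊗ ℂᵈ`. -/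
noncomputable def antisymProj (d : ℕ) : Matrix (Fin d × Fin d) (Fin d × Fin d) ℂ :=
  (1 / 2 : ℂ) • (1 - swapMatrix d)

theorem swapMatrix_mulVec (d : ℕ) (v : Fin d × Fin d → ℂ) :
    (swapMatrix d).mulVec v = fun x => v x.swap := by
  funext x
  have h : ∀ y : Fin d × Fin d, (x = y.swap) = (x.swap = y) := fun y =>
    propext ⟨fun h => by rw [h, Prod.swap_swap], fun h => by rw [← h, Prod.swap_swap]⟩
  simp [swapMatrix, Matrix.mulVec, dotProduct, h]

theorem swapMatrix_conjTranspose (d : ℕ) : (swapMatrix d).conjTranspose = swapMatrix d := by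
  ext x y
  have h : (y = x.swap) = (x = y.swap) :=
    propext ⟨fun h => by rw [h, Prod.swap_swap], fun h => by rw [h, Prod.swap_swap]⟩
  by_cases hx : x = y.swap <;> simp [swapMatrix, Matrix.conjTranspose_apply, h, hx]

theorem swapMatrix_mul_self (d : ℕ) : swapMatrix d * swapMatrix d = 1 := by
  refine Matrix.ext_of_mulVec_single fun x => ?_
  rw [← Matrix.mulVec_mulVec, swapMatrix_mulVec, swapMatrix_mulVec,
    Matrix.one_mulVec]
  simp only [Prod.swap_swap]

/-- `symProj` is an orthogonal projector. -/
theorem symProj_isStarProjection (d : ℕ) : IsStarProjection (symProj d) := by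
  constructor
  · unfold IsIdempotentElem symProj
    rw [smul_mul_smul_comm, mul_add, add_mul, add_mul, swapMatrix_mul_self]
    ext x y
    simp
    ring
  · rw [isSelfAdjoint_iff, Matrix.star_eq_conjTranspose]
    simp [symProj, Matrix.conjTranspose_smul, swapMatrix_conjTranspose]

/-- `symProj` projects onto the symmetric vectors. -/
theorem symProj_mulVec_eq_iff (d : ℕ) (v : Fin d × Fin d → ℂ) :
    (symProj d).mulVec v = v ↔ ∀ i j, v (i, j) = v (j, i) := by
  rw [symProj, Matrix.smul_mulVec, Matrix.add_mulVec, Matrix.one_mulVec, swapMatrix_mulVec,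
    funext_iff, Prod.forall]
  refine forall₂_congr fun i j => ?_
  simp only [Pi.smul_apply, Pi.add_apply, smul_eq_mul, Prod.swap_prod_mk]
  constructor <;> intro h
  · linear_combination (-2 : ℂ) * h
  · linear_combination (-1 / 2 : ℂ) * h

/-- `antisymProj` is the complementary projector, and it projects onto the antisymmetric
vectors. -/
theorem antisymProj_eq (d : ℕ) : antisymProj d = 1 - symProj d := by
  ext x y
  simp [symProj, antisymProj]
  ring

theorem antisymProj_mulVec_eq_iff (d : ℕ) (v : Fin d × Fin d → ℂ) :
    (antisymProj d).mulVec v = v ↔ ∀ i j, v (i, j) = -v (j, i) := by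
  rw [antisymProj, Matrix.smul_mulVec, Matrix.sub_mulVec, Matrix.one_mulVec, swapMatrix_mulVec,
    funext_iff, Prod.forall]
  refine forall₂_congr fun i j => ?_
  simp only [Pi.smul_apply, Pi.sub_apply, smul_eq_mul, Prod.swap_prod_mk]
  constructor <;> intro h
  · linear_combination (-2 : ℂ) * h
  · linear_combination (-1 / 2 : ℂ) * h

/-- The `d`-dimensional Werner state
`σ_AB = 2(1-t)/(d(d+1)) Π⁺ + 2t/(d(d-1)) Π⁻` with parameter `t`. -/
noncomputable def wernerState (d : ℕ) (t : ℝ) : Matrix (Fin d × Fin d) (Fin d × Fin d) ℂ :=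
  ((2 * (1 - t) / (d * (d + 1)) : ℝ) : ℂ) • symProj d +
    ((2 * t / (d * (d - 1)) : ℝ) : ℂ) • antisymProj d

/-- The rank-one projective measurement `{|e_z⟩⟨e_z|}` in an orthonormal basis. -/
noncomputable def POVM.ofBasis {d : ℕ}
    (e : OrthonormalBasis (Fin d) ℂ (EuclideanSpace ℂ (Fin d))) : POVM (Fin d) (Fin d) where
  effect z := Matrix.vecMulVec (fun i => e z i) (fun i => star (e z i))
  posSemidef z := Matrix.posSemidef_vecMulVec_self_star (fun i => e z i)
  sum_eq_one := by
    refine Matrix.ext_of_mulVec_single fun k => ?_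
    have h := congrArg (fun v : EuclideanSpace ℂ (Fin d) => (v : Fin d → ℂ))
      (e.sum_repr' (EuclideanSpace.single k (1 : ℂ)))
    funext i
    have h' := congrFun h i
    simpa [Matrix.sum_apply, Matrix.vecMulVec_apply, mul_comm, Matrix.one_apply, Pi.single_apply,
      EuclideanSpace.inner_single_right] using h'

/-- The vector `|x̃⟩ = d^{-1/2} ∑_z exp(2πi x z / d) |e_z⟩`. -/
noncomputable def fourierVector {d : ℕ}
    (e : OrthonormalBasis (Fin d) ℂ (EuclideanSpace ℂ (Fin d))) (x : Fin d) :
    EuclideanSpace ℂ (Fin d) :=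
  ((1 / Real.sqrt d : ℝ) : ℂ) •
    ∑ z : Fin d, Complex.exp (2 * Real.pi * Complex.I * (x : ℕ) * (z : ℕ) / d) • e z

theorem orthonormal_fourierVector {d : ℕ}
    (e : OrthonormalBasis (Fin d) ℂ (EuclideanSpace ℂ (Fin d))) :
    Orthonormal ℂ (fourierVector e) := by
  rw [orthonormal_iff_ite]
  intro x y
  have hd : 0 < d := x.pos
  have hdC : (d : ℂ) ≠ 0 := by exact_mod_cast hd.ne'
  have hsq : ((Real.sqrt d : ℝ) : ℂ) * ((Real.sqrt d : ℝ) : ℂ) = d := by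
    rw [← Complex.ofReal_mul, Real.mul_self_sqrt (Nat.cast_nonneg d)]
    simp
  set ζ : ℂ := Complex.exp (2 * Real.pi * Complex.I * (((y : ℕ) : ℂ) - ((x : ℕ) : ℂ)) / d)
    with hζ
  have hterm : ∀ z : Fin d,
      (starRingEnd ℂ) (Complex.exp (2 * Real.pi * Complex.I * (x : ℕ) * (z : ℕ) / d)) *
        Complex.exp (2 * Real.pi * Complex.I * (y : ℕ) * (z : ℕ) / d) = ζ ^ (z : ℕ) := by
    intro z
    rw [← Complex.exp_conj, ← Complex.exp_add, hζ, ← Complex.exp_nat_mul]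
    congr 1
    simp [map_ofNat]
    ring
  have hsum : inner ℂ (fourierVector e x) (fourierVector e y)
      = (1 / (d : ℂ)) * ∑ z : Fin d, ζ ^ (z : ℕ) := by
    rw [fourierVector, fourierVector, inner_smul_left, inner_smul_right, e.orthonormal.inner_sum]
    rw [Finset.sum_congr rfl fun z _ => hterm z, ← mul_assoc, ← hsq]
    simp [Complex.conj_ofReal]
  rw [hsum, Fin.sum_univ_eq_sum_range (fun n => ζ ^ n) d]
  split_ifs with hxy
  · subst hxy
    simp [hζ, hdC]
  · have hpow : ζ ^ d = 1 := by
      rw [hζ, ← Complex.exp_nat_mul, Complex.exp_eq_one_iff]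
      refine ⟨((y : ℕ) : ℤ) - ((x : ℕ) : ℤ), ?_⟩
      push_cast
      field_simp
    have hne : ζ ≠ 1 := by
      rw [hζ, Ne, Complex.exp_eq_one_iff]
      rintro ⟨n, hn⟩
      have hpi : (2 * (Real.pi : ℂ) * Complex.I) ≠ 0 := Complex.two_pi_I_ne_zero
      have h1 : (((y : ℕ) : ℂ) - ((x : ℕ) : ℂ)) = n * d := by
        field_simp at hn
        linear_combination hn
      have h2 : ((y : ℕ) : ℤ) - ((x : ℕ) : ℤ) = n * d := by exact_mod_cast h1
      have h3 : ((y : ℕ) : ℤ) - ((x : ℕ) : ℤ) = 0 := by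
        refine Int.eq_zero_of_abs_lt_dvd (m := (d : ℤ)) ⟨n, by rw [h2, mul_comm]⟩ ?_
        have := x.isLt
        have := y.isLt
        rw [abs_lt]
        omega
      exact hxy (Fin.ext (by omega))
    rw [geom_sum_eq hne, hpow]
    simp

/-- The basis Fourier-conjugate to the orthonormal basis `e`. -/
noncomputable def fourierConjugateBasis {d : ℕ}
    (e : OrthonormalBasis (Fin d) ℂ (EuclideanSpace ℂ (Fin d))) :
    OrthonormalBasis (Fin d) ℂ (EuclideanSpace ℂ (Fin d)) :=
  OrthonormalBasis.mk (orthonormal_fourierVector e)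
    ((orthonormal_fourierVector e).linearIndependent.span_eq_top_of_card_eq_finrank'
      (by simp)).ge

end QuantumMemory

/-!
A Werner state is a combination `r • 1 + s • F` of the identity and the swap `F`. Measuring an
effect `Λ` on the first half therefore leaves the memory in the unnormalized state
`(tr Λ * r) • 1 + s • Λ` (`traceLeft_effect_mul`), and every entropy in the theorem is a sum over
eigenvalues of such blocks. The entropy is additive over blocks
(`entropy_sum_single_kronecker`), so no diagonalization of the whole post-measurement state is
needed.

*Classical correlation.* The eigenvalues of the block left by `Λ` are affine in those of `Λ`, and
they are mixtures of the eigenvalues left by a rank-one effect. By concavity of `-y log₂ y`, the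
rank-one effects leave the least entropy (`le_entropy_block`). Hence the projective measurement in
any orthonormal basis attains the maximum (`isGreatest_measuredInfos`), and its value, like that
of the conditional entropies `S(Z|B)` and `S(X|B)`, does not depend on the basis. The first two
expressions for the uncertainty sum then agree by direct computation, as the overlap of
Fourier-conjugate bases is `1 / √d`.

*Sign of discord minus classical correlation.* It remains to see that `D - J` is nonnegative, that
is, `S(σ) + 2 log₂ d ≤ S(σ_Z) + S(σ_X)` for the dephased states `σ_Z` and `σ_X`. This would
follow from the monotonicity of the relative entropy under the `X`-dephasing, as
`D(σ‖σ_Z) ≥ D(σ_X‖1/d²)`. For Werner states `σ` and `σ_Z` commute, and the channel acts on their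
common eigenvectors as an explicit classical stochastic map with two outputs, so two applications
of Jensen's inequality suffice (`werner_entropy_add_two_mul_logb_le`).
-/

open scoped Kronecker ComplexOrder

namespace QuantumMemory

/-! ### Entropy from resolutions of the identity into eigenmatrices -/

open Polynomial in
theorem aeval_mul_of_mul_eq_smul {n : Type*} [Fintype n] [DecidableEq n]
    {A P : Matrix n n ℂ} {r : ℝ} (h : A * P = r • P) (q : ℝ[X]) :
    aeval A q * P = q.eval r • P := by
  induction q using Polynomial.induction_on' with
  | add p q hp hq => rw [map_add, add_mul, hp, hq, eval_add, add_smul]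
  | monomial k c =>
    have hk : A ^ k * P = r ^ k • P := by
      induction k with
      | zero => simp
      | succ k ih => rw [pow_succ, mul_assoc, h, mul_smul_comm, ih, smul_smul, pow_succ']
    rw [aeval_monomial, eval_monomial, mul_assoc, hk, Algebra.algebraMap_eq_smul_one,
      smul_mul_assoc, one_mul, smul_smul]

/-- On the columns of an eigenmatrix the functional calculus acts by the scalar `g r`. No
continuity is needed: on the finite spectrum `g` agrees with an interpolating polynomial. -/
theorem cfc_mul_of_mul_eq_smul {n : Type*} [Fintype n] [DecidableEq n]
    {A P : Matrix n n ℂ} {r : ℝ} (hA : A.IsHermitian) (h : A * P = r • P) (g : ℝ → ℝ) :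
    cfc g A * P = g r • P := by
  classical
  set s : Finset ℝ := insert r A.finite_real_spectrum.toFinset with hs
  have hq : ∀ x ∈ s, (Lagrange.interpolate s id g).eval x = g x := fun x hx =>
    Lagrange.eval_interpolate_at_node (v := id) g (Set.injOn_id _) hx
  have hcfc : cfc g A = Polynomial.aeval A (Lagrange.interpolate s id g) := by
    rw [← cfc_polynomial _ A hA.isSelfAdjoint]
    exact cfc_congr fun x hx => (hq x (by simp [hs, hx])).symm
  rw [hcfc, aeval_mul_of_mul_eq_smul h, hq r (by simp [hs])]

theorem cfc_eq_sum {n κ : Type*} [Fintype n] [DecidableEq n] [Fintype κ]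
    {A : Matrix n n ℂ} (hA : A.IsHermitian) {P : κ → Matrix n n ℂ} {f : κ → ℝ}
    (h : ∀ k, A * P k = f k • P k) (hP : ∑ k, P k = 1) (g : ℝ → ℝ) :
    cfc g A = ∑ k, g (f k) • P k := by
  rw [← mul_one (cfc g A), ← hP, Finset.mul_sum]
  exact Finset.sum_congr rfl fun k _ => cfc_mul_of_mul_eq_smul hA (h k) g

/-- The function `-y log₂ y`, the summand of the entropy in bits. It vanishes at `0`. -/
noncomputable def negMulLogb (y : ℝ) : ℝ := Real.negMulLog y / Real.log 2

theorem negMulLogb_eq (y : ℝ) : negMulLogb y = -(y * Real.logb 2 y) := by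
  simp only [negMulLogb, Real.negMulLog, Real.logb]; ring

theorem negMulLogb_mul (x y : ℝ) : negMulLogb (x * y) = y * negMulLogb x + x * negMulLogb y := by
  simp only [negMulLogb, Real.negMulLog_mul]; ring

theorem concaveOn_negMulLogb : ConcaveOn ℝ (Set.Ici (0 : ℝ)) negMulLogb := by
  have h := Real.concaveOn_negMulLog.smul (c := (Real.log 2)⁻¹)
    (inv_nonneg.2 (Real.log_nonneg one_le_two))
  refine h.congr fun x _ => ?_
  simp [negMulLogb, div_eq_inv_mul]

/-- The entropy from a resolution of the identity into eigenmatrices `P k`. These need be neither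
Hermitian nor orthogonal to each other, and the values `f k` need not be distinct. -/
theorem entropy_eq_sum {n κ : Type*} [Fintype n] [DecidableEq n] [Fintype κ]
    {A : Matrix n n ℂ} (hA : A.IsHermitian) {P : κ → Matrix n n ℂ} {f : κ → ℝ}
    (h : ∀ k, A * P k = f k • P k) (hP : ∑ k, P k = 1) :
    entropy A = ∑ k, negMulLogb (f k) * (P k).trace.re := by
  rw [entropy, cfc_eq_sum hA h hP, Finset.mul_sum, Matrix.trace_sum, Complex.re_sum,
    ← Finset.sum_neg_distrib]
  refine Finset.sum_congr rfl fun k _ => ?_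
  rw [mul_smul_comm, h, smul_smul, Matrix.trace_smul, Complex.smul_re, negMulLogb_eq, smul_eq_mul]
  ring

/-- The spectral theorem as a resolution of the identity by eigenmatrices of trace one. -/
theorem exists_eigenprojections {n : Type*} [Fintype n] [DecidableEq n]
    {A : Matrix n n ℂ} (hA : A.IsHermitian) :
    ∃ Q : n → Matrix n n ℂ, (∀ i, A * Q i = hA.eigenvalues i • Q i) ∧ ∑ i, Q i = 1 ∧
      ∀ i, (Q i).trace = 1 := by
  set U : Matrix n n ℂ := (hA.eigenvectorUnitary : Matrix n n ℂ) with hU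
  have h1 : star U * U = 1 := Unitary.coe_star_mul_self hA.eigenvectorUnitary
  have h2 : U * star U = 1 := Unitary.coe_mul_star_self hA.eigenvectorUnitary
  refine ⟨fun i => U * Matrix.single i i 1 * star U, fun i => ?_, ?_, fun i => ?_⟩
  · have hs : A = U * Matrix.diagonal (RCLike.ofReal ∘ hA.eigenvalues) * star U := by
      conv_lhs => rw [hA.spectral_theorem, Unitary.conjStarAlgAut_apply]
    have hd : Matrix.diagonal (RCLike.ofReal ∘ hA.eigenvalues) * Matrix.single i i (1 : ℂ)
        = hA.eigenvalues i • Matrix.single i i (1 : ℂ) := by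
      ext a b
      simp only [Matrix.diagonal_mul, Matrix.smul_apply, Matrix.single_apply, Function.comp]
      split_ifs with hab
      · simp [hab.1]
      · simp
    calc A * (U * Matrix.single i i 1 * star U)
        = U * Matrix.diagonal (RCLike.ofReal ∘ hA.eigenvalues) * (star U * U)
            * Matrix.single i i 1 * star U := by
          conv_lhs => rw [hs]
          simp only [mul_assoc]
      _ = _ := by
          rw [h1, mul_one, mul_assoc U, hd, mul_smul_comm, smul_mul_assoc]
  · rw [← Finset.sum_mul, ← Finset.mul_sum, Matrix.sum_single_one, mul_one, h2]
  · rw [Matrix.trace_mul_comm, ← mul_assoc, h1, one_mul, Matrix.trace_single_eq_same]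

theorem entropy_smul_one_add_smul {n : Type*} [Fintype n] [DecidableEq n]
    {A : Matrix n n ℂ} (hA : A.IsHermitian) (r s : ℝ) :
    entropy (r • (1 : Matrix n n ℂ) + s • A) = ∑ i, negMulLogb (r + s * hA.eigenvalues i) := by
  obtain ⟨Q, hAQ, hQ, htr⟩ := exists_eigenprojections hA
  have hH : (r • (1 : Matrix n n ℂ) + s • A).IsHermitian := by
    simp [Matrix.IsHermitian, hA.eq]
  rw [entropy_eq_sum hH (f := fun i => r + s * hA.eigenvalues i) (fun i => ?_) hQ]
  · simp [htr]
  · rw [add_mul, smul_mul_assoc, smul_mul_assoc, hAQ, one_mul, smul_smul, add_smul]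

theorem entropy_eq_sum_eigenvalues {n : Type*} [Fintype n] [DecidableEq n]
    {A : Matrix n n ℂ} (hA : A.IsHermitian) : entropy A = ∑ i, negMulLogb (hA.eigenvalues i) := by
  simpa using entropy_smul_one_add_smul hA 0 1

theorem entropy_smul_one (n : Type*) [Fintype n] [DecidableEq n] (r : ℝ) :
    entropy (r • (1 : Matrix n n ℂ)) = Fintype.card n * negMulLogb r := by
  simpa using entropy_smul_one_add_smul (A := (0 : Matrix n n ℂ)) Matrix.isHermitian_zero r 0

theorem entropy_diagonal {n : Type*} [Fintype n] [DecidableEq n] (f : n → ℝ) :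
    entropy (Matrix.diagonal fun i => (f i : ℂ)) = ∑ i, negMulLogb (f i) := by
  have hH : (Matrix.diagonal fun i => (f i : ℂ)).IsHermitian := by
    simp [Matrix.IsHermitian, Matrix.diagonal_conjTranspose, Pi.star_def]
  rw [entropy_eq_sum hH (P := fun i => Matrix.single i i 1) (f := f) (fun i => ?_)
    (Matrix.sum_single_one)]
  · simp
  · ext a b
    simp only [Matrix.diagonal_mul, Matrix.smul_apply, Matrix.single_apply]
    split_ifs with hab
    · simp [hab.1]
    · simp

/-- The entropy of a classical-quantum state is the sum of the entropies of its (unnormalized)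
blocks. -/
theorem entropy_sum_single_kronecker {ι b : Type*} [Fintype ι] [DecidableEq ι]
    [Fintype b] [DecidableEq b] {B : ι → Matrix b b ℂ} (hB : ∀ x, (B x).IsHermitian) :
    entropy (∑ x, Matrix.single x x (1 : ℂ) ⊗ₖ B x) = ∑ x, entropy (B x) := by
  choose Q hBQ hQ htr using fun x => exists_eigenprojections (hB x)
  have hH : (∑ x, Matrix.single x x (1 : ℂ) ⊗ₖ B x).IsHermitian := by
    simp [Matrix.IsHermitian, Matrix.conjTranspose_sum, Matrix.conjTranspose_kronecker, (hB _).eq]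
  have hP : ∑ k : ι × b, Matrix.single k.1 k.1 (1 : ℂ) ⊗ₖ Q k.1 k.2 = 1 := by
    have hk : ∀ x, ∑ y, Matrix.single x x (1 : ℂ) ⊗ₖ Q x y
        = Matrix.single x x (1 : ℂ) ⊗ₖ (1 : Matrix b b ℂ) := fun x => by
      rw [← hQ x]; ext; simp [Matrix.sum_apply, Finset.mul_sum]
    have hs : ∑ x : ι, Matrix.single x x (1 : ℂ) ⊗ₖ (1 : Matrix b b ℂ)
        = (∑ x : ι, Matrix.single x x (1 : ℂ)) ⊗ₖ (1 : Matrix b b ℂ) := by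
      ext; simp [Matrix.sum_apply, Finset.sum_mul]
    rw [Fintype.sum_prod_type, Finset.sum_congr rfl fun x _ => hk x, hs, Matrix.sum_single_one,
      Matrix.one_kronecker_one]
  rw [entropy_eq_sum hH (f := fun k => (hB k.1).eigenvalues k.2) (fun k => ?_) hP]
  · simp [Fintype.sum_prod_type, Matrix.trace_kronecker, htr, entropy_eq_sum_eigenvalues (hB _)]
  · rw [Finset.sum_mul, Finset.sum_eq_single k.1]
    · rw [← Matrix.mul_kronecker_mul, hBQ, Matrix.single_mul_single_same, mul_one,
        Matrix.kronecker_smul]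
    · intro x _ hx
      rw [← Matrix.mul_kronecker_mul, Matrix.single_mul_single_of_ne _ _ _ _ hx,
        Matrix.zero_kronecker]
    · simp

/-! ### Marginals of classical-quantum states and traces of effects -/

theorem traceLeft_sum_single_kronecker {ι b : Type*} [Fintype ι] [DecidableEq ι]
    (B : ι → Matrix b b ℂ) :
    traceLeft (∑ x, Matrix.single x x (1 : ℂ) ⊗ₖ B x) = ∑ x, B x := by
  ext i j
  simp only [traceLeft, Matrix.of_apply, Matrix.sum_apply, Matrix.kroneckerMap_apply]
  rw [Finset.sum_comm]
  simp [Matrix.single_apply]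

theorem traceRight_sum_single_kronecker {ι b : Type*} [Fintype ι] [DecidableEq ι] [Fintype b]
    (B : ι → Matrix b b ℂ) :
    traceRight (∑ x, Matrix.single x x (1 : ℂ) ⊗ₖ B x)
      = Matrix.diagonal fun x => (B x).trace := by
  ext i j
  simp only [traceRight, Matrix.of_apply, Matrix.sum_apply, Matrix.kroneckerMap_apply]
  by_cases h : i = j
  · subst h
    simp [Matrix.single_apply, Matrix.trace]
  · rw [Matrix.diagonal_apply_ne _ h]
    refine Finset.sum_eq_zero fun k _ => Finset.sum_eq_zero fun x _ => ?_
    rw [Matrix.single_apply, if_neg (by rintro ⟨rfl, rfl⟩; exact h rfl), zero_mul]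

theorem POVM.sum_trace_re {ι a : Type*} [Fintype ι] [Fintype a] [DecidableEq a] (P : POVM ι a) :
    ∑ x, (P.effect x).trace.re = Fintype.card a := by
  rw [← Complex.re_sum, ← Matrix.trace_sum, P.sum_eq_one, Matrix.trace_one]
  simp

theorem ofReal_trace_re {a : Type*} [Fintype a] {A : Matrix a a ℂ} (hA : A.IsHermitian) :
    ((A.trace.re : ℝ) : ℂ) = A.trace := by
  refine Complex.conj_eq_iff_re.1 ?_
  change star A.trace = A.trace
  rw [← Matrix.trace_conjTranspose, hA.eq]

theorem trace_re_eq_sum_eigenvalues {a : Type*} [Fintype a] [DecidableEq a] {A : Matrix a a ℂ}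
    (hA : A.IsHermitian) : A.trace.re = ∑ i, hA.eigenvalues i := by
  rw [hA.trace_eq_sum_eigenvalues]; simp

/-! ### Measurements on states spanned by the identity and the swap -/

/-- Measuring one half of `r • 1 + s • F` leaves a block spanned by the identity and the effect
itself. -/
theorem traceLeft_effect_mul {d : ℕ} {Λ : Matrix (Fin d) (Fin d) ℂ} (hΛ : Λ.IsHermitian)
    (r s : ℝ) :
    traceLeft ((Λ ⊗ₖ (1 : Matrix (Fin d) (Fin d) ℂ)) * (r • 1 + s • swapMatrix d))
      = (Λ.trace.re * r) • 1 + s • Λ := by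
  rw [mul_add, mul_smul_comm, mul_smul_comm, mul_one]
  ext i j
  have h : ∀ k, ((Λ ⊗ₖ (1 : Matrix (Fin d) (Fin d) ℂ)) * swapMatrix d) (k, i) (k, j)
      = if i = k then Λ k j else 0 := fun k => by
    rw [Matrix.mul_apply, Finset.sum_eq_single (j, k)]
    · simp [swapMatrix, Matrix.one_apply]
    · intro y _ hy
      have : ¬ y = (j, k) := hy
      simp [swapMatrix, this]
    · simp
  have h1 : ∀ k, (Λ ⊗ₖ (1 : Matrix (Fin d) (Fin d) ℂ)) (k, i) (k, j)
      = Λ k k * (1 : Matrix (Fin d) (Fin d) ℂ) i j := fun k => rfl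
  have ht : ∑ k, Λ k k = ((Λ.trace.re : ℝ) : ℂ) := (ofReal_trace_re hΛ).symm
  simp only [traceLeft, Matrix.of_apply, Matrix.add_apply, Matrix.smul_apply, h, h1,
    Finset.sum_add_distrib, ← Finset.smul_sum]
  rw [← Finset.sum_mul, ht, Finset.sum_ite_eq, if_pos (Finset.mem_univ _)]
  simp only [Complex.real_smul, Complex.ofReal_mul]
  ring

theorem block_isHermitian {a : Type*} [DecidableEq a] {Λ : Matrix a a ℂ}
    (hΛ : Λ.IsHermitian) (r s : ℝ) : (r • (1 : Matrix a a ℂ) + s • Λ).IsHermitian := by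
  simp [Matrix.IsHermitian, hΛ.eq]

theorem postMeasurement_eq {ι : Type*} [Fintype ι] [DecidableEq ι] {d : ℕ}
    (P : POVM ι (Fin d)) (r s : ℝ) :
    postMeasurement P (r • 1 + s • swapMatrix d)
      = ∑ x, Matrix.single x x (1 : ℂ) ⊗ₖ
          (((P.effect x).trace.re * r) • 1 + s • P.effect x) := by
  simp only [postMeasurement, traceLeft_effect_mul (P.posSemidef _).1]

theorem entropy_postMeasurement {ι : Type*} [Fintype ι] [DecidableEq ι] {d : ℕ}
    (P : POVM ι (Fin d)) (r s : ℝ) :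
    entropy (postMeasurement P (r • 1 + s • swapMatrix d))
      = ∑ x, entropy (((P.effect x).trace.re * r) • 1 + s • P.effect x) := by
  rw [postMeasurement_eq, entropy_sum_single_kronecker fun x =>
    block_isHermitian (P.posSemidef x).1 _ _]

theorem traceLeft_postMeasurement {ι : Type*} [Fintype ι] [DecidableEq ι] {d : ℕ}
    (P : POVM ι (Fin d)) (r s : ℝ) :
    traceLeft (postMeasurement P (r • 1 + s • swapMatrix d))
      = (d * r + s) • (1 : Matrix (Fin d) (Fin d) ℂ) := by
  rw [postMeasurement_eq, traceLeft_sum_single_kronecker, Finset.sum_add_distrib,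
    ← Finset.sum_smul, ← Finset.sum_mul, P.sum_trace_re, ← Finset.smul_sum, P.sum_eq_one,
    ← add_smul, Fintype.card_fin]

theorem traceRight_postMeasurement {ι : Type*} [Fintype ι] [DecidableEq ι] {d : ℕ}
    (P : POVM ι (Fin d)) (r s : ℝ) :
    traceRight (postMeasurement P (r • 1 + s • swapMatrix d))
      = Matrix.diagonal fun x => (((P.effect x).trace.re * (d * r + s) : ℝ) : ℂ) := by
  rw [postMeasurement_eq, traceRight_sum_single_kronecker]
  congr 1
  funext x
  rw [Matrix.trace_add, Matrix.trace_smul, Matrix.trace_smul, Matrix.trace_one,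
    ← ofReal_trace_re (P.posSemidef x).1]
  simp only [Complex.real_smul, Complex.ofReal_mul, Fintype.card_fin, Complex.ofReal_add,
    Complex.ofReal_natCast, Complex.ofReal_re]
  ring

theorem measCondEntropy_eq {ι : Type*} [Fintype ι] [DecidableEq ι] {d : ℕ}
    (P : POVM ι (Fin d)) (r s : ℝ) :
    measCondEntropy P (r • 1 + s • swapMatrix d)
      = ∑ x, entropy (((P.effect x).trace.re * r) • 1 + s • P.effect x)
        - d * negMulLogb (d * r + s) := by
  rw [measCondEntropy, condEntropy, entropy_postMeasurement, traceLeft_postMeasurement,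
    entropy_smul_one, Fintype.card_fin]

theorem mutualInfo_postMeasurement {ι : Type*} [Fintype ι] [DecidableEq ι] {d : ℕ}
    (P : POVM ι (Fin d)) (r s : ℝ) :
    mutualInfo (postMeasurement P (r • 1 + s • swapMatrix d))
      = d * negMulLogb (d * r + s)
        + ∑ x, (negMulLogb ((P.effect x).trace.re * (d * r + s))
          - entropy (((P.effect x).trace.re * r) • 1 + s • P.effect x)) := by
  rw [mutualInfo, entropy_postMeasurement, traceLeft_postMeasurement,
    entropy_smul_one, Fintype.card_fin, traceRight_postMeasurement, entropy_diagonal,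
    Finset.sum_sub_distrib]
  ring

/-- The entropy of the block left by a rank-one projector: one eigenvalue `r + s`, and `r` with
multiplicity `d - 1`. -/
noncomputable def pureBlockEntropy (d : ℕ) (r s : ℝ) : ℝ :=
  negMulLogb (r + s) + (d - 1) * negMulLogb r

theorem negMulLogb_zero : negMulLogb 0 = 0 := by simp [negMulLogb]

theorem negMulLogb_one : negMulLogb 1 = 0 := by simp [negMulLogb]

/-- The eigenvalues of an idempotent are `0` and `1`, and on them any function is affine; its trace
thus gives the entropy without counting multiplicities. -/
theorem entropy_smul_one_add_smul_of_isIdempotentElem {n : Type*} [Fintype n] [DecidableEq n]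
    {A : Matrix n n ℂ} (hA : A.IsHermitian) (hi : IsIdempotentElem A) (r s : ℝ) :
    entropy (r • (1 : Matrix n n ℂ) + s • A)
      = A.trace.re * negMulLogb (r + s) + (Fintype.card n - A.trace.re) * negMulLogb r := by
  have h01 : ∀ i, hA.eigenvalues i = 0 ∨ hA.eigenvalues i = 1 := fun i => by
    simpa using hi.spectrum_subset ℝ (hA.eigenvalues_mem_spectrum_real i)
  have hterm : ∀ i, negMulLogb (r + s * hA.eigenvalues i)
      = negMulLogb r + hA.eigenvalues i * (negMulLogb (r + s) - negMulLogb r) := fun i => by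
    rcases h01 i with h | h <;> simp [h]
  rw [entropy_smul_one_add_smul hA, Finset.sum_congr rfl fun i _ => hterm i,
    Finset.sum_add_distrib, ← Finset.sum_mul, ← trace_re_eq_sum_eigenvalues hA]
  simp
  ring

/-- Among the blocks of a given trace, the rank-one ones carry the
least entropy. The term `negMulLogb w * (d * r + s)` comes from normalizing the block. -/
theorem le_entropy_block {d : ℕ} {Λ : Matrix (Fin d) (Fin d) ℂ} (hΛ : Λ.PosSemidef)
    {r s : ℝ} (hr : 0 ≤ r) (hrs : 0 ≤ r + s) :
    Λ.trace.re * pureBlockEntropy d r s + negMulLogb Λ.trace.re * (d * r + s)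
      ≤ entropy ((Λ.trace.re * r) • 1 + s • Λ) := by
  have hw := trace_re_eq_sum_eigenvalues hΛ.1
  set w := Λ.trace.re with hwdef
  have h0 : ∀ i, 0 ≤ hΛ.1.eigenvalues i := hΛ.eigenvalues_nonneg
  have hle : ∀ i, hΛ.1.eigenvalues i ≤ w := fun i => by
    rw [hw]; exact Finset.single_le_sum (fun i _ => h0 i) (Finset.mem_univ i)
  have hw0 : 0 ≤ w := by rw [hw]; exact Finset.sum_nonneg fun i _ => h0 i
  rw [entropy_smul_one_add_smul hΛ.1]
  -- With `m = λ / w`, the eigenvalue `w * r + s * λ` is `w` times the convex combination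
  -- `(1 - m) * r + m * (r + s)`.
  have key : ∀ i, (w - hΛ.1.eigenvalues i) * negMulLogb r
      + hΛ.1.eigenvalues i * negMulLogb (r + s)
      + (w * r + s * hΛ.1.eigenvalues i) / w * negMulLogb w
      ≤ negMulLogb (w * r + s * hΛ.1.eigenvalues i) := fun i => by
    rcases hw0.eq_or_lt with hz | hpos
    · have : hΛ.1.eigenvalues i = 0 := le_antisymm (hz ▸ hle i) (h0 i)
      simp [this, ← hz, negMulLogb_zero]
    · set m := hΛ.1.eigenvalues i / w with hm
      have hlam : hΛ.1.eigenvalues i = w * m := by rw [hm]; field_simp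
      have hm0 : 0 ≤ m := div_nonneg (h0 i) hw0
      have hm1 : m ≤ 1 := (div_le_one hpos).2 (hle i)
      have hj := concaveOn_negMulLogb.2 (Set.mem_Ici.2 hr) (Set.mem_Ici.2 hrs)
        (sub_nonneg.2 hm1) hm0 (by ring)
      simp only [smul_eq_mul] at hj
      rw [show (1 - m) * r + m * (r + s) = r + s * m by ring] at hj
      have hmul := negMulLogb_mul w (r + s * m)
      rw [hlam, show w * r + s * (w * m) = w * (r + s * m) by ring, hmul,
        mul_div_cancel_left₀ _ hpos.ne']
      nlinarith [mul_le_mul_of_nonneg_left hj hw0]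
  refine le_trans (le_of_eq ?_) (Finset.sum_le_sum fun i _ => key i)
  have hs : ∑ i, s * hΛ.1.eigenvalues i = s * w := by rw [← Finset.mul_sum, ← hw]
  rw [Finset.sum_add_distrib, Finset.sum_add_distrib, ← Finset.sum_mul, ← Finset.sum_mul,
    ← Finset.sum_mul, ← Finset.sum_div, Finset.sum_sub_distrib, Finset.sum_add_distrib,
    hs, ← hw, pureBlockEntropy]
  rcases hw0.eq_or_lt with hz | hpos
  · simp [← hz, negMulLogb_zero]
  · simp only [Finset.sum_const, Finset.card_univ, Fintype.card_fin, nsmul_eq_mul]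
    field_simp
    ring

theorem mutualInfo_postMeasurement_le {ι : Type*} [Fintype ι] [DecidableEq ι] {d : ℕ}
    (P : POVM ι (Fin d)) {r s : ℝ} (hr : 0 ≤ r) (hrs : 0 ≤ r + s) :
    mutualInfo (postMeasurement P (r • 1 + s • swapMatrix d))
      ≤ 2 * d * negMulLogb (d * r + s) - d * pureBlockEntropy d r s := by
  rw [mutualInfo_postMeasurement]
  have h : ∀ x, negMulLogb ((P.effect x).trace.re * (d * r + s))
      - entropy (((P.effect x).trace.re * r) • 1 + s • P.effect x)
      ≤ (P.effect x).trace.re * (negMulLogb (d * r + s) - pureBlockEntropy d r s) := fun x => by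
    rw [negMulLogb_mul]
    linarith [le_entropy_block (P.posSemidef x) hr hrs]
  have hs := Finset.sum_le_sum fun x (_ : x ∈ Finset.univ) => h x
  rw [← Finset.sum_mul, P.sum_trace_re, Fintype.card_fin] at hs
  linarith

theorem POVM.ofBasis_isIdempotentElem {d : ℕ}
    (e : OrthonormalBasis (Fin d) ℂ (EuclideanSpace ℂ (Fin d))) (z : Fin d) :
    IsIdempotentElem ((POVM.ofBasis e).effect z) := by
  have h : inner ℂ (e z) (e z) = 1 := by simp
  rw [EuclideanSpace.inner_eq_star_dotProduct, dotProduct_comm] at h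
  simp only [IsIdempotentElem, POVM.ofBasis, Matrix.vecMulVec_mul_vecMulVec]
  rw [show ((fun i => star (e z i)) ⬝ᵥ fun i => e z i) = 1 from h]
  simp

theorem POVM.ofBasis_trace {d : ℕ}
    (e : OrthonormalBasis (Fin d) ℂ (EuclideanSpace ℂ (Fin d))) (z : Fin d) :
    ((POVM.ofBasis e).effect z).trace = 1 := by
  have h : inner ℂ (e z) (e z) = 1 := by simp
  rw [EuclideanSpace.inner_eq_star_dotProduct] at h
  rw [POVM.ofBasis, Matrix.trace_vecMulVec]
  exact h

theorem entropy_ofBasis_block {d : ℕ}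
    (e : OrthonormalBasis (Fin d) ℂ (EuclideanSpace ℂ (Fin d))) (z : Fin d) (r s : ℝ) :
    entropy ((((POVM.ofBasis e).effect z).trace.re * r) • 1 + s • (POVM.ofBasis e).effect z)
      = pureBlockEntropy d r s := by
  rw [POVM.ofBasis_trace, Complex.one_re, one_mul]
  rw [entropy_smul_one_add_smul_of_isIdempotentElem ((POVM.ofBasis e).posSemidef z).1
    (POVM.ofBasis_isIdempotentElem e z), POVM.ofBasis_trace, Complex.one_re, Fintype.card_fin,
    one_mul, pureBlockEntropy]

theorem measCondEntropy_ofBasis {d : ℕ}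
    (e : OrthonormalBasis (Fin d) ℂ (EuclideanSpace ℂ (Fin d))) (r s : ℝ) :
    measCondEntropy (POVM.ofBasis e) (r • 1 + s • swapMatrix d)
      = d * pureBlockEntropy d r s - d * negMulLogb (d * r + s) := by
  rw [measCondEntropy_eq, Finset.sum_congr rfl fun z _ => entropy_ofBasis_block e z r s]
  simp

theorem mutualInfo_postMeasurement_ofBasis {d : ℕ}
    (e : OrthonormalBasis (Fin d) ℂ (EuclideanSpace ℂ (Fin d))) (r s : ℝ) :
    mutualInfo (postMeasurement (POVM.ofBasis e) (r • 1 + s • swapMatrix d))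
      = 2 * d * negMulLogb (d * r + s) - d * pureBlockEntropy d r s := by
  rw [mutualInfo_postMeasurement, Finset.sum_congr rfl fun z _ =>
    by rw [entropy_ofBasis_block e z r s, POVM.ofBasis_trace, Complex.one_re, one_mul]]
  simp
  ring

/-- The classical correlation is attained by every projective measurement in an orthonormal
basis. -/
theorem isGreatest_measuredInfos {d : ℕ}
    (e : OrthonormalBasis (Fin d) ℂ (EuclideanSpace ℂ (Fin d))) {r s : ℝ}
    (hr : 0 ≤ r) (hrs : 0 ≤ r + s) :
    IsGreatest (measuredInfos (r • 1 + s • swapMatrix d))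
      (2 * d * negMulLogb (d * r + s) - d * pureBlockEntropy d r s) := by
  refine ⟨⟨d, POVM.ofBasis e, (mutualInfo_postMeasurement_ofBasis e r s).symm⟩, ?_⟩
  rintro _ ⟨n, P, rfl⟩
  exact mutualInfo_postMeasurement_le P hr hrs

/-! ### The entropy inequality behind the sign of the discord gap -/

theorem negMulLogb_sq {x : ℝ} (hx : 0 < x) :
    negMulLogb (x ^ 2) = -(2 * x ^ 2 * Real.logb 2 x) := by
  rw [negMulLogb_eq, ← Real.rpow_natCast, Real.logb_rpow_eq_mul_logb_of_pos hx]
  push_cast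
  ring

/-- The inequality `S(σ) + 2 log₂ x ≤ 2 S(σ_Z)` for a Werner state `σ` of dimension `x` with
eigenvalues `p` (symmetric) and `q` (antisymmetric): dephasing in a basis leaves the eigenvalue `p`
on the `x` diagonal vectors and `(p + q) / 2` on the others. A second, conjugate dephasing sends a
diagonal vector to the conjugate diagonal with probability `1 / x`, an off-diagonal symmetric one
with probability `2 / x`, and an antisymmetric one never; the two Jensen inequalities belong to the two
outputs of this stochastic map. -/
theorem werner_entropy_add_two_mul_logb_le {x p q : ℝ} (hx : 2 ≤ x) (hp : 0 ≤ p) (hq : 0 ≤ q)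
    (hpq : p + (x - 1) * ((p + q) / 2) = 1 / x) :
    x * (x + 1) / 2 * negMulLogb p + x * (x - 1) / 2 * negMulLogb q + 2 * Real.logb 2 x
      ≤ 2 * x * (negMulLogb p + (x - 1) * negMulLogb ((p + q) / 2)) := by
  have hx0 : 0 < x := by linarith
  set a := (p + q) / 2 with ha
  have ha0 : 0 < a := by
    rcases (show 0 ≤ a by positivity).eq_or_lt with h | h
    · exfalso
      have hp' : p = 0 := by linarith
      rw [← h, hp'] at hpq
      have : 0 < 1 / x := by positivity
      linarith
    · exact h
  obtain ⟨u, hu⟩ : ∃ u, p = u * a := ⟨p / a, by field_simp⟩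
  obtain ⟨v, hv⟩ : ∃ v, q = v * a := ⟨q / a, by field_simp⟩
  have hu0 : 0 ≤ u := nonneg_of_mul_nonneg_left (hu ▸ hp) ha0
  have hv0 : 0 ≤ v := nonneg_of_mul_nonneg_left (hv ▸ hq) ha0
  have huv : u + v = 2 := by
    have : (u + v) * a = 2 * a := by rw [add_mul, ← hu, ← hv, ha]; ring
    exact mul_right_cancel₀ ha0.ne' this
  have hnorm : x * p + x * (x - 1) * a = 1 := by
    have := congrArg (x * ·) hpq
    simp only [mul_one_div_cancel hx0.ne'] at this
    linarith
  -- Likelihood ratios `p / p = 1` and `p / a = u`, for the outputs on the diagonal.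
  have h1 : x * (x - 1) * a * negMulLogb u ≤ negMulLogb (x ^ 2 * p) := by
    have h := concaveOn_negMulLogb.2 (Set.mem_Ici.2 zero_le_one) (Set.mem_Ici.2 hu0)
      (show 0 ≤ x * p by positivity)
      (show 0 ≤ x * (x - 1) * a from mul_nonneg (mul_nonneg hx0.le (by linarith)) ha0.le) hnorm
    simp only [smul_eq_mul, negMulLogb_one, mul_zero, zero_add, mul_one] at h
    rwa [show x * p + x * (x - 1) * a * u = x ^ 2 * p by rw [hu]; ring] at h
  -- Likelihood ratios `1`, `u` and `q / a = v`, for the outputs off the diagonal.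
  have h2 : x * (x - 2) / 2 * a * negMulLogb u + x ^ 2 / 2 * a * negMulLogb v
      ≤ negMulLogb (x ^ 2 * a) := by
    have h := concaveOn_negMulLogb.le_map_sum (t := Finset.univ)
      (w := ![x * p, x * (x - 2) / 2 * a, x ^ 2 / 2 * a]) (p := ![1, u, v]) ?_ ?_ ?_
    · simp only [Fin.sum_univ_three, Matrix.cons_val, smul_eq_mul, negMulLogb_one, mul_zero,
        zero_add, mul_one] at h
      rwa [show x * p + x * (x - 2) / 2 * a * u + x ^ 2 / 2 * a * v = x ^ 2 * a by
        rw [hu, show v = 2 - u by linarith]; ring] at h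
    · intro i _
      fin_cases i
      · exact mul_nonneg hx0.le hp
      · exact mul_nonneg (div_nonneg (mul_nonneg hx0.le (by linarith)) zero_le_two) ha0.le
      · simp only [Fin.reduceFinMk, Matrix.cons_val]; positivity
    · simp only [Fin.sum_univ_three, Matrix.cons_val]
      linarith
    · intro i _
      fin_cases i
      · exact Set.mem_Ici.2 zero_le_one
      · exact Set.mem_Ici.2 hu0
      · exact Set.mem_Ici.2 hv0
  rw [negMulLogb_mul, negMulLogb_sq hx0] at h1 h2
  have ep : negMulLogb p = a * negMulLogb u + u * negMulLogb a := by rw [hu, negMulLogb_mul]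
  have eq : negMulLogb q = a * negMulLogb v + v * negMulLogb a := by rw [hv, negMulLogb_mul]
  -- Add the two inequalities with weights `1 / x` and `(x - 1) / x`.
  have h1' : (x - 1) * a * negMulLogb u ≤ x * negMulLogb p - 2 * x * p * Real.logb 2 x := by
    refine le_of_mul_le_mul_left ?_ hx0
    linarith
  have h2' : (x - 1) * ((x - 2) / 2 * a * negMulLogb u + x / 2 * a * negMulLogb v)
      ≤ (x - 1) * (x * negMulLogb a - 2 * x * a * Real.logb 2 x) := by
    refine mul_le_mul_of_nonneg_left ?_ (by linarith)
    refine le_of_mul_le_mul_left ?_ hx0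
    linarith
  have hL : 2 * Real.logb 2 x = 2 * x * p * Real.logb 2 x
      + (x - 1) * (2 * x * a * Real.logb 2 x) := by
    linear_combination (-2 * Real.logb 2 x) * hnorm
  have hv' : v = 2 - u := by linarith
  rw [ep] at h1' ⊢
  rw [eq, hL, hv']
  rw [hv'] at h2'
  linarith

/-! ### The incompatibility of Fourier-conjugate bases -/

theorem cfc_sqrt_ofBasis {d : ℕ}
    (e : OrthonormalBasis (Fin d) ℂ (EuclideanSpace ℂ (Fin d))) (z : Fin d) :
    cfc Real.sqrt ((POVM.ofBasis e).effect z) = (POVM.ofBasis e).effect z := by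
  refine (cfc_congr (g := id) fun x hx => ?_).trans
    (cfc_id ℝ _ ((POVM.ofBasis e).posSemidef z).1.isSelfAdjoint)
  rcases (POVM.ofBasis_isIdempotentElem e z).spectrum_subset ℝ hx with h | h
  · simp [h]
  · simp [Set.mem_singleton_iff.1 h]

theorem toEuclideanCLM_vecMulVec {d : ℕ} (u v : EuclideanSpace ℂ (Fin d)) :
    Matrix.toEuclideanCLM (n := Fin d) (𝕜 := ℂ) (Matrix.vecMulVec (fun i => u i)
      (fun i => star (v i))) = InnerProductSpace.rankOne ℂ u v := by
  ext w i
  simp [Matrix.vecMulVec_mulVec, EuclideanSpace.inner_eq_star_dotProduct, dotProduct_comm]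
  exact mul_comm _ _

theorem norm_effect_mul_effect {d : ℕ}
    (e f : OrthonormalBasis (Fin d) ℂ (EuclideanSpace ℂ (Fin d))) (z x : Fin d) :
    ‖Matrix.toEuclideanCLM (n := Fin d) (𝕜 := ℂ)
      ((POVM.ofBasis e).effect z * (POVM.ofBasis f).effect x)‖ = ‖inner ℂ (e z) (f x)‖ := by
  simp only [map_mul, POVM.ofBasis, toEuclideanCLM_vecMulVec]
  rw [ContinuousLinearMap.mul_def, InnerProductSpace.rankOne_comp_rankOne]
  simp [norm_smul]

theorem norm_inner_fourierConjugateBasis {d : ℕ}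
    (e : OrthonormalBasis (Fin d) ℂ (EuclideanSpace ℂ (Fin d))) (z x : Fin d) :
    ‖inner ℂ (e z) (fourierConjugateBasis e x)‖ = 1 / Real.sqrt d := by
  rw [fourierConjugateBasis, OrthonormalBasis.coe_mk, fourierVector, inner_smul_right,
    e.orthonormal.inner_right_fintype, norm_mul, Complex.norm_real, Complex.norm_exp]
  have h : (2 * Real.pi * Complex.I * (x : ℕ) * (z : ℕ) / d : ℂ).re = 0 := by
    rw [show (2 * Real.pi * Complex.I * (x : ℕ) * (z : ℕ) / d : ℂ)
      = ((2 * Real.pi * (x : ℕ) * (z : ℕ) / d : ℝ) : ℂ) * Complex.I by push_cast; ring]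
    simp only [Complex.re_ofReal_mul, Complex.I_re, mul_zero]
  rw [h, Real.exp_zero, mul_one, Real.norm_of_nonneg (by positivity)]

theorem incompatibility_fourierConjugateBasis {d : ℕ} [NeZero d]
    (e : OrthonormalBasis (Fin d) ℂ (EuclideanSpace ℂ (Fin d))) :
    incompatibility (POVM.ofBasis e) (POVM.ofBasis (fourierConjugateBasis e))
      = 1 / Real.sqrt d := by
  simp only [incompatibility, cfc_sqrt_ofBasis, norm_effect_mul_effect,
    norm_inner_fourierConjugateBasis, ciSup_const]

/-! ### The Werner state -/

/-- The eigenvalue of the Werner state on the symmetric subspace. -/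
noncomputable def symEigenvalue (d : ℕ) (t : ℝ) : ℝ := 2 * (1 - t) / (d * (d + 1))

/-- The eigenvalue of the Werner state on the antisymmetric subspace. -/
noncomputable def antisymEigenvalue (d : ℕ) (t : ℝ) : ℝ := 2 * t / (d * (d - 1))

theorem wernerState_eq_one_add_swap (d : ℕ) (t : ℝ) :
    wernerState d t
      = ((symEigenvalue d t + antisymEigenvalue d t) / 2) • 1
        + ((symEigenvalue d t - antisymEigenvalue d t) / 2) • swapMatrix d := by
  ext i j
  simp only [wernerState, symProj, antisymProj, Matrix.add_apply, Matrix.sub_apply,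
    Matrix.smul_apply, smul_eq_mul, Complex.real_smul, symEigenvalue, antisymEigenvalue]
  push_cast
  ring

theorem wernerState_eq_one_add_symProj (d : ℕ) (t : ℝ) :
    wernerState d t
      = antisymEigenvalue d t • 1
        + (symEigenvalue d t - antisymEigenvalue d t) • symProj d := by
  ext i j
  simp only [wernerState, antisymProj_eq, Matrix.add_apply, Matrix.sub_apply,
    Matrix.smul_apply, smul_eq_mul, Complex.real_smul, symEigenvalue, antisymEigenvalue]
  push_cast
  ring

theorem trace_symProj (d : ℕ) : (symProj d).trace = (d * (d + 1) / 2 : ℝ) := by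
  have h : (swapMatrix d).trace = d := by
    simp only [Matrix.trace, Matrix.diag_apply, swapMatrix, Matrix.of_apply,
      Fintype.sum_prod_type, Prod.swap_prod_mk, Prod.mk.injEq]
    have : ∀ i j : Fin d, (i = j ∧ j = i) ↔ i = j := fun i j => ⟨And.left, fun h => ⟨h, h.symm⟩⟩
    simp [this]
  rw [symProj, Matrix.trace_smul, Matrix.trace_add, h, Matrix.trace_one]
  simp
  ring

theorem entropy_wernerState (d : ℕ) (t : ℝ) :
    entropy (wernerState d t) = d * (d + 1) / 2 * negMulLogb (symEigenvalue d t)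
      + d * (d - 1) / 2 * negMulLogb (antisymEigenvalue d t) := by
  rw [wernerState_eq_one_add_symProj, entropy_smul_one_add_smul_of_isIdempotentElem
    (symProj_isStarProjection d).isSelfAdjoint (symProj_isStarProjection d).isIdempotentElem,
    trace_symProj, Complex.ofReal_re, add_sub_cancel, Fintype.card_prod, Fintype.card_fin]
  push_cast
  ring

theorem traceLeft_one_add_swap (d : ℕ) (r s : ℝ) :
    traceLeft (r • 1 + s • swapMatrix d) = (d * r + s) • 1 := by
  have h := traceLeft_effect_mul (d := d) Matrix.isHermitian_one r s
  rw [Matrix.one_kronecker_one, one_mul] at h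
  rw [h, ← add_smul]
  simp

theorem traceRight_one_add_swap (d : ℕ) (r s : ℝ) :
    traceRight (r • 1 + s • swapMatrix d) = (d * r + s) • 1 := by
  rw [← traceLeft_one_add_swap]
  ext i j
  simp only [traceLeft, traceRight, Matrix.of_apply, Matrix.add_apply, Matrix.smul_apply,
    swapMatrix, Matrix.one_apply, Prod.mk.injEq, Prod.swap_prod_mk, and_comm, eq_comm]

theorem condEntropy_wernerState {d : ℕ} (t : ℝ) {m : ℝ}
    (hm : d * ((symEigenvalue d t + antisymEigenvalue d t) / 2)
      + (symEigenvalue d t - antisymEigenvalue d t) / 2 = m) :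
    condEntropy (wernerState d t) = entropy (wernerState d t) - d * negMulLogb m := by
  have h : traceLeft (wernerState d t) = m • 1 := by
    rw [wernerState_eq_one_add_swap, traceLeft_one_add_swap, hm]
  rw [condEntropy, h, entropy_smul_one, Fintype.card_fin]

theorem mutualInfo_wernerState {d : ℕ} (t : ℝ) {m : ℝ}
    (hm : d * ((symEigenvalue d t + antisymEigenvalue d t) / 2)
      + (symEigenvalue d t - antisymEigenvalue d t) / 2 = m) :
    mutualInfo (wernerState d t) = 2 * d * negMulLogb m - entropy (wernerState d t) := by
  have h : traceLeft (wernerState d t) = m • 1 := by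
    rw [wernerState_eq_one_add_swap, traceLeft_one_add_swap, hm]
  have h' : traceRight (wernerState d t) = m • 1 := by
    rw [wernerState_eq_one_add_swap, traceRight_one_add_swap, hm]
  rw [mutualInfo, h, h', entropy_smul_one, Fintype.card_fin]
  ring

/-- Both marginals of the Werner state are maximally mixed. -/
theorem wernerState_marginal_eigenvalue {d : ℕ} (hd : 2 ≤ d) (t : ℝ) :
    d * ((symEigenvalue d t + antisymEigenvalue d t) / 2)
      + (symEigenvalue d t - antisymEigenvalue d t) / 2 = 1 / (d : ℝ) := by
  have h2 : (2 : ℝ) ≤ d := by exact_mod_cast hd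
  have h1 : (d : ℝ) - 1 ≠ 0 := by linarith
  have h3 : (d : ℝ) + 1 ≠ 0 := by linarith
  have h0 : (d : ℝ) ≠ 0 := by linarith
  rw [symEigenvalue, antisymEigenvalue]
  field_simp
  ring

end QuantumMemory

open QuantumMemory in
theorem mainTheorem3 (d : ℕ) (hd : 2 ≤ d) (t : ℝ) (ht0 : 0 ≤ t) (ht1 : t ≤ 1)
    (e : OrthonormalBasis (Fin d) ℂ (EuclideanSpace ℂ (Fin d))) :
    let σ := wernerState d t
    let Z := POVM.ofBasis e
    let X := POVM.ofBasis (fourierConjugateBasis e)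
    let value : ℝ :=
      -(4 * (1 - t) / (d + 1)) * Real.logb 2 (2 * (1 - t) / (d + 1))
        - 2 * (d - 1 + 2 * t) / (d + 1) * Real.logb 2 ((d - 1 + 2 * t) / (d ^ 2 - 1))
    -- the classical correlation is a maximum over all POVMs
    IsGreatest (measuredInfos σ) (classicalCorrelation σ) ∧
    -- the uncertainty sum
    measCondEntropy Z σ + measCondEntropy X σ = value ∧
    -- the new lower bound
    -2 * Real.logb 2 (incompatibility Z X) + condEntropy σ
      + (discord σ - classicalCorrelation σ) = value ∧
    -2 * Real.logb 2 (incompatibility Z X) + condEntropy σ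
      + max 0 (discord σ - classicalCorrelation σ) = value ∧
    -- the lower bound of Berta et al.
    -2 * Real.logb 2 (incompatibility Z X) + condEntropy σ =
      -t * Real.logb 2 (2 * t / (d * (d - 1)))
        - (1 - t) * Real.logb 2 (2 * (1 - t) / (d * (d + 1))) := by
  intro σ Z X value
  have : NeZero d := ⟨by omega⟩
  have h2 : (2 : ℝ) ≤ d := by exact_mod_cast hd
  have h1 : (0 : ℝ) < d - 1 := by linarith
  have h0 : (0 : ℝ) < d := by linarith
  have h3 : (0 : ℝ) < d + 1 := by linarith
  have hp : 0 ≤ symEigenvalue d t :=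
    div_nonneg (mul_nonneg zero_le_two (sub_nonneg.2 ht1)) (mul_nonneg h0.le h3.le)
  have hq : 0 ≤ antisymEigenvalue d t :=
    div_nonneg (mul_nonneg zero_le_two ht0) (mul_nonneg h0.le h1.le)
  have hm := wernerState_marginal_eigenvalue hd t
  have hS := entropy_wernerState d t
  have hC := condEntropy_wernerState t hm
  have hI := mutualInfo_wernerState t hm
  have hL : (d : ℝ) * negMulLogb (1 / d) = Real.logb 2 d := by
    rw [negMulLogb_eq, one_div, Real.logb_inv]
    field_simp
  have hσ := wernerState_eq_one_add_swap d t
  set p := symEigenvalue d t with hpdef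
  set q := antisymEigenvalue d t with hqdef
  have hE : pureBlockEntropy d ((p + q) / 2) ((p - q) / 2)
      = negMulLogb p + (d - 1) * negMulLogb ((p + q) / 2) := by
    rw [pureBlockEntropy, show (p + q) / 2 + (p - q) / 2 = p by ring]
  have hGr := isGreatest_measuredInfos e (r := (p + q) / 2) (s := (p - q) / 2) (by positivity)
    (by linarith)
  rw [← hσ, hm, hE] at hGr
  have hJ : classicalCorrelation (wernerState d t) = _ := hGr.csSup_eq
  have hZX : ∀ f : OrthonormalBasis (Fin d) ℂ (EuclideanSpace ℂ (Fin d)),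
      measCondEntropy (POVM.ofBasis f) (wernerState d t) = _ := fun f => by
    rw [hσ, measCondEntropy_ofBasis, hm, hE, hL]
  have hc : -2 * Real.logb 2 (incompatibility Z X) = Real.logb 2 d := by
    rw [incompatibility_fourierConjugateBasis, one_div, Real.logb_inv, Real.sqrt_eq_rpow,
      Real.logb_rpow_eq_mul_logb_of_pos h0]
    ring
  have hge := werner_entropy_add_two_mul_logb_le h2 hp hq (by linarith)
  -- The arguments of the logarithms in `value` are `d` times the eigenvalues `p` and
  -- `(p + q) / 2` of the post-measurement state.
  have hvalue : value = 2 * d * (negMulLogb p + (d - 1) * negMulLogb ((p + q) / 2))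
      - 2 * Real.logb 2 d := by
    have hdlog : negMulLogb (d : ℝ) = -(d * Real.logb 2 d) := negMulLogb_eq _
    have hP : 2 * (1 - t) / (d + 1) = p * d := by
      rw [hpdef, symEigenvalue]; field_simp
    have hR : (d - 1 + 2 * t) / ((d : ℝ) ^ 2 - 1) = (p + q) / 2 * d := by
      have : (d : ℝ) ^ 2 - 1 = (d - 1) * (d + 1) := by ring
      rw [hpdef, hqdef, symEigenvalue, antisymEigenvalue, this]
      field_simp
      ring
    have hP' := negMulLogb_mul p d
    have hR' := negMulLogb_mul ((p + q) / 2) d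
    have hv : value = 2 * negMulLogb (p * d) + 2 * (d - 1) * negMulLogb ((p + q) / 2 * d) := by
      rw [negMulLogb_eq, negMulLogb_eq, ← hP, ← hR]
      have : (d : ℝ) ^ 2 - 1 = (d - 1) * (d + 1) := by ring
      simp only [value, this]
      field_simp
      ring
    have hn : (d : ℝ) * p + d * (d - 1) * ((p + q) / 2) = 1 := by
      have := congrArg ((d : ℝ) * ·) hm
      simp only [mul_one_div_cancel h0.ne'] at this
      linarith
    rw [hv, hP', hR', hdlog]
    linear_combination (-2 * Real.logb 2 d) * hn
  have hS' : entropy (wernerState d t) = -t * Real.logb 2 (2 * t / (d * (d - 1)))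
        - (1 - t) * Real.logb 2 (2 * (1 - t) / (d * (d + 1))) := by
    rw [hS, negMulLogb_eq, negMulLogb_eq, hpdef, hqdef, symEigenvalue, antisymEigenvalue]
    field_simp
    ring
  have hdisc : discord (wernerState d t) - classicalCorrelation (wernerState d t)
      = value - entropy (wernerState d t) := by
    rw [discord, hI, hJ, hvalue]
    linear_combination (-2 : ℝ) * hL
  refine ⟨hJ ▸ hGr, ?_, ?_, ?_, ?_⟩
  · simp only [σ, Z, X, hZX, hvalue]; ring
  · rw [hc, hC, hdisc, hL]; ring
  · rw [hc, hC, hdisc, hL, max_eq_right (by rw [hvalue, hS]; linarith)]; ring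
  · rw [hc, hC, hL, ← hS']; ring
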